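/- Let $\{p_k\}_{k\ge 1}$ be a sequence of primes and put $p:=p_1$. Let $K$ be a field with $\operatorname{char}K\neq p_k$ for every $k\ge 1$ that contains a primitive $p$-th root of unity. For every $k\ge 1$ let $f_k=a_kx^{p_k}+b_k\in K[x]$ with $a_k\neq 0$, let $\mathcal F:=\{f_k\}_{k\ge 1}$, let $\alpha\in K$, and put $f^{(n)}:=f_1\circ f_2\circ\cdots\circ f_n$ for $n\ge 1$, and $f^{(0)}:=x$. For $n\ge 1$ set $$c_{n,\alpha}(\mathcal F):=\begin{cases}\alpha-f_1(0) & \text{if } p_1=2 \text{ and } n=1,\\ f^{(n)}(0)-\alpha & \text{otherwise.}\end{cases}$$ Let $G_\infty(\mathcal F,\alpha)$ be the Galois group over $K$ of the subfield of a separable closure $K^{\mathrm{sep}}$ generated over $K$ by all $\beta\in K^{\mathrm{sep}}$ such that $f^{(n)}(\beta)=\alpha$ for some $n\ge 0$. Suppose that $c_{n,\alpha}(\mathcal F)\neq 0$ for every $n\ge 1$ and that $f_1-\alpha$ is irreducible over $K$. If $G_\infty(\mathcal F,\alpha)$ is abelian, then the classes of the elements $$\frac{c_{n,\alpha}(\mathcal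 F)}{a_1}\qquad (n\ge 1,\ p_n=p)$$ span a $1$-dimensional subspace of the $\mathbb F_p$-vector space $K^\times/K^{\times p}$. -/

import Mathlib

open Polynomial

namespace Arboreal

noncomputable section

/-- The sequence `f_k = a_k x ^ d_k + b_k`; only the indices `k ≥ 1` are ever used. -/
def unicriticalSeq {K : Type*} [Field K] (d : ℕ → ℕ) (a b : ℕ → K) (k : ℕ) : K[X] :=
  C (a k) * X ^ d k + C (b k)

/-- `compSeq f n = f_1 ∘ f_2 ∘ ⋯ ∘ f_n`, with `compSeq f 0 = x`. -/
def compSeq {K : Type*} [Field K] (f : ℕ → K[X]) : ℕ → K[X]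
  | 0 => X
  | n + 1 => (compSeq f n).comp (f (n + 1))

/-- The adjusted post-critical orbit of the sequence `f_k = a_k x ^ d_k + b_k` at `α`. -/
def adjustedPostCritical {K : Type*} [Field K] (d : ℕ → ℕ) (a b : ℕ → K) (α : K) (n : ℕ) : K :=
  if d 1 = 2 ∧ n = 1 then α - (unicriticalSeq d a b 1).eval 0
  else (compSeq (unicriticalSeq d a b) n).eval 0 - α

/-- The nodes of the tree of iterated preimages of `α`, inside the separable closure of `K`. -/
def treeNodes {K : Type*} [Field K] (f : ℕ → K[X]) (α : K) : Set (SeparableClosure K) :=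
  {β | ∃ n : ℕ, aeval β (compSeq f n) = algebraMap K (SeparableClosure K) α}

/-- The field generated over `K` by all the nodes of the tree. -/
def arborealField {K : Type*} [Field K] (f : ℕ → K[X]) (α : K) :
    IntermediateField K (SeparableClosure K) :=
  IntermediateField.adjoin K (treeNodes f α)

/-- The group `G_∞(F, α)`: the Galois group over `K` of the field generated by the tree. -/
abbrev ArborealGroup {K : Type*} [Field K] (f : ℕ → K[X]) (α : K) : Type _ :=
  arborealField f α ≃ₐ[K] arborealField f α

/-- The group `Kˣ / (Kˣ) ^ p`, written additively. -/
def PowerClasses (K : Type*) [Field K] (p : ℕ) : Type _ :=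
  Additive (Kˣ ⧸ (powMonoidHom p : Kˣ →* Kˣ).range)

instance (K : Type*) [Field K] (p : ℕ) : AddCommGroup (PowerClasses K p) :=
  inferInstanceAs (AddCommGroup (Additive (Kˣ ⧸ (powMonoidHom p : Kˣ →* Kˣ).range)))

/-- The class of a unit in `Kˣ / (Kˣ) ^ p`. -/
def powerClass {K : Type*} [Field K] (p : ℕ) (u : Kˣ) : PowerClasses K p :=
  Additive.ofMul (QuotientGroup.mk u)

theorem nsmul_powerClasses_eq_zero {K : Type*} [Field K] (p : ℕ) (x : PowerClasses K p) :
    p • x = 0 := by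
  obtain ⟨u, rfl⟩ : ∃ u : Kˣ, powerClass p u = x := QuotientGroup.mk_surjective x
  exact congrArg Additive.ofMul
    ((QuotientGroup.eq_one_iff (N := (powMonoidHom p : Kˣ →* Kˣ).range) (u ^ p)).2 ⟨u, rfl⟩)

/-- `Kˣ / (Kˣ) ^ p` as a module over `ℤ / p`. -/
instance (K : Type*) [Field K] (p : ℕ) : Module (ZMod p) (PowerClasses K p) :=
  AddCommGroup.zmodModule (nsmul_powerClasses_eq_zero p)

end

end Arboreal

namespace Arboreal

/-! ### Compositions and degrees -/

section Compositions

variable {K : Type*} [Field K]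

/-! Put c = (α - b₁)/a₁, not a p-th power by irreducibility, and β ^ p = c. The element for n = 1 is
±c, with the class of c. For n ≥ 2 with pₙ = p it equals g ^ p - c, where g = (f₂ ∘ ⋯ ∘ fₙ)(0),
which is the norm of g - β from K(β). Factoring over the tree gives g - β = B w ^ p with B in K and
w in the arboreal field (`exists_aeval_sub_eq_mul_pow`). Commutativity makes the product of the
conjugates of w under powers of some σ moving β lie in K(β), and σ scales it by a root of unity, so
it is β ^ k times an element of K. Hence g ^ p - c is c ^ k times a p-th power
(`exists_pow_sub_eq_pow_mul_pow`), and all the classes lie on the line of c. -/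

theorem compSeq_succ_eq_comp (f : ℕ → K[X]) (n : ℕ) :
    compSeq f (n + 1) = (f 1).comp (compSeq (fun k => f (k + 1)) n) := by
  induction n with
  | zero => simp [compSeq]
  | succ n ih => rw [compSeq, ih, comp_assoc]; rfl

theorem natDegree_compSeq_ne_zero (f : ℕ → K[X]) (hf : ∀ k, 1 ≤ k → (f k).natDegree ≠ 0)
    (n : ℕ) : (compSeq f n).natDegree ≠ 0 := by
  induction n with
  | zero => simp [compSeq]
  | succ n ih =>
    rw [compSeq, natDegree_comp]
    exact mul_ne_zero ih (hf _ (by omega))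

theorem natDegree_unicriticalSeq (d : ℕ → ℕ) (a b : ℕ → K) (k : ℕ)
    (ha : a k ≠ 0) : (unicriticalSeq d a b k).natDegree = d k := by
  rw [unicriticalSeq, natDegree_add_C, natDegree_C_mul_X_pow _ _ ha]

theorem natCast_ne_zero_of_ringChar_ne {q : ℕ} (hq : q.Prime) (h : ringChar K ≠ q) :
    (q : K) ≠ 0 := by
  intro h0
  rcases (Nat.dvd_prime hq).1 ((ringChar.spec K q).1 h0) with h1 | h1
  · exact CharP.ringChar_ne_one h1
  · exact h h1

end Compositions

/-! ### Splitting of the tree polynomials -/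

section Splitting

variable {K L : Type*} [Field K] [Field L] [Algebra K L]

/-- If all the translates of `q` split then `q.comp f` inherits this property from `f`. -/
theorem splits_map_comp_sub_C {q f : K[X]}
    (hq : ∀ β : L, (q.map (algebraMap K L) - C β).Splits)
    (hf : ∀ β : L, (f.map (algebraMap K L) - C β).Splits) (β : L) :
    ((q.comp f).map (algebraMap K L) - C β).Splits := by
  have h : (q.comp f).map (algebraMap K L) - C β
      = (q.map (algebraMap K L) - C β).comp (f.map (algebraMap K L)) := by
    rw [sub_comp, C_comp, Polynomial.map_comp]
  rw [h, (hq β).eq_prod_roots, mul_comp, C_comp, multiset_prod_comp, Multiset.map_map]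
  refine (Splits.C _).mul (Splits.multisetProd ?_)
  simp only [Multiset.mem_map]
  rintro _ ⟨γ, -, rfl⟩
  simpa using hf γ

theorem splits_X_pow_sub_C [IsSepClosed L] {n : ℕ} (hn : (n : L) ≠ 0) (c : L) :
    (X ^ n - C c : L[X]).Splits := by
  -- For c = 0 the polynomial is inseparable in general, but it is a power of X.
  by_cases hc : c = 0
  · simp [hc]
  · exact IsSepClosed.splits_of_separable _ (separable_X_pow_sub_C c hn hc)

theorem splits_map_unicriticalSeq_sub_C [IsSepClosed L] (d : ℕ → ℕ) (a b : ℕ → K) (k : ℕ)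
    (hd : (d k : K) ≠ 0) (ha : a k ≠ 0) (β : L) :
    ((unicriticalSeq d a b k).map (algebraMap K L) - C β).Splits := by
  have ha' : algebraMap K L (a k) ≠ 0 := by simpa using ha
  have h : (unicriticalSeq d a b k).map (algebraMap K L) - C β
      = C (algebraMap K L (a k)) *
        (X ^ d k - C ((β - algebraMap K L (b k)) / algebraMap K L (a k))) := by
    rw [mul_sub, ← C_mul, mul_div_cancel₀ _ ha']
    simp [unicriticalSeq]
    ring
  rw [h]
  refine (Splits.C _).mul (splits_X_pow_sub_C ?_ _)
  rw [← map_natCast (algebraMap K L)]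
  exact (_root_.map_ne_zero _).2 hd

theorem splits_map_compSeq_sub_C (f : ℕ → K[X])
    (hf : ∀ k, 1 ≤ k → ∀ β : L, ((f k).map (algebraMap K L) - C β).Splits) (n : ℕ) (β : L) :
    ((compSeq f n).map (algebraMap K L) - C β).Splits := by
  induction n generalizing β with
  | zero => simp [compSeq]
  | succ n ih => exact splits_map_comp_sub_C ih (hf _ (by omega)) β

/-- If `a δ ^ e + b` hits every root of `q - β`, then `q(b) - β` is a constant multiple of the
`e`-th power of a product of such `δ`. -/
theorem exists_aeval_sub_eq_mul_pow (S : Subfield L) {q : K[X]} (hq0 : q.natDegree ≠ 0) {β : L}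
    (hq : (q.map (algebraMap K L) - C β).Splits) {a b : K} (ha : a ≠ 0) (e : ℕ)
    (h : ∀ γ, aeval γ q = β → ∃ δ ∈ S, algebraMap K L a * δ ^ e + algebraMap K L b = γ) :
    ∃ B : K, B ≠ 0 ∧ ∃ w ∈ S,
      algebraMap K L (q.eval b) - β = algebraMap K L B * w ^ e := by
  set r := q.map (algebraMap K L) - C β with hr
  have hdeg : r.natDegree = q.natDegree := by rw [hr, natDegree_sub_C, natDegree_map]
  have hlead : r.leadingCoeff = algebraMap K L q.leadingCoeff := by
    rw [leadingCoeff, hdeg, hr, coeff_sub, coeff_C_of_ne_zero hq0, sub_zero, coeff_map]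
    rfl
  have hval : algebraMap K L (q.eval b) - β = r.eval (algebraMap K L b) := by
    rw [hr, eval_sub, eval_C, eval_map, eval₂_at_apply]
  have hroots : ∀ γ ∈ r.roots, ∃ δ ∈ S, algebraMap K L b - γ = algebraMap K L (-a) * δ ^ e := by
    intro γ hγ
    have h0 := isRoot_of_mem_roots hγ
    rw [IsRoot.def, hr, eval_sub, eval_C, eval_map_algebraMap, sub_eq_zero] at h0
    obtain ⟨δ, hδ, e1⟩ := h γ h0
    refine ⟨δ, hδ, ?_⟩
    rw [← e1, map_neg]
    ring
  have hprod : ∀ s : Multiset L,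
      (∀ γ ∈ s, ∃ δ ∈ S, algebraMap K L b - γ = algebraMap K L (-a) * δ ^ e) →
      ∃ w ∈ S, (s.map (algebraMap K L b - ·)).prod
        = algebraMap K L ((-a) ^ s.card) * w ^ e := by
    intro s
    induction s using Multiset.induction with
    | empty => exact fun _ => ⟨1, S.one_mem, by simp⟩
    | cons γ s ih =>
      intro hs
      obtain ⟨w, hw, e1⟩ := ih fun γ' h' => hs γ' (Multiset.mem_cons_of_mem h')
      obtain ⟨δ, hδ, e2⟩ := hs γ (Multiset.mem_cons_self _ _)
      refine ⟨δ * w, S.mul_mem hδ hw, ?_⟩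
      rw [Multiset.map_cons, Multiset.prod_cons, e1, e2, Multiset.card_cons, pow_succ, map_mul]
      ring
  obtain ⟨w, hw, e1⟩ := hprod _ hroots
  refine ⟨q.leadingCoeff * (-a) ^ r.roots.card, ?_, w, hw, ?_⟩
  · refine mul_ne_zero ?_ (pow_ne_zero _ (neg_ne_zero.2 ha))
    rintro h0
    rw [leadingCoeff_eq_zero] at h0
    simp [h0] at hq0
  · rw [hval, hq.eval_eq_prod_roots, hlead, e1, map_mul]
    ring

end Splitting

/-! ### Kummer theory -/

section Kummer

variable {K L : Type*} [Field K] [Field L] [Algebra K L]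

theorem exists_rootOfUnity_smul {n : ℕ} [NeZero n] {ζ : K} (hζ : IsPrimitiveRoot ζ n) {x y : L}
    (h : x ^ n = y ^ n) : ∃ i, x = algebraMap K L ζ ^ i * y := by
  by_cases hy : y = 0
  · subst hy
    refine ⟨0, ?_⟩
    rw [zero_pow (NeZero.ne n)] at h
    simpa [NeZero.ne n] using h
  · have h1 : (x / y) ^ n = 1 := by rw [div_pow, h, div_self (pow_ne_zero _ hy)]
    obtain ⟨i, -, hi⟩ :=
      (hζ.map_of_injective (algebraMap K L).injective).eq_pow_of_pow_eq_one h1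
    exact ⟨i, by rw [hi, div_mul_cancel₀ _ hy]⟩

/-- Abelian Kummer theory: if `g - β` is, up to a constant of `K`, a `p`-th power of an element
on which the Galois group acts through a commutative quotient, then the norm `g ^ p - β ^ p` is
a power of `β ^ p` times a `p`-th power. -/
theorem exists_pow_sub_eq_pow_mul_pow [IsGalois K L] {p : ℕ} (hp : p.Prime) {ζ : K}
    (hζ : IsPrimitiveRoot ζ p) {c : K} (hc : ∀ u : K, u ^ p ≠ c) {β : L}
    (hβ : β ^ p = algebraMap K L c) {g B : K} (hB : B ≠ 0) {w : L}
    (hw : algebraMap K L g - β = algebraMap K L B * w ^ p)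
    (hcomm : ∀ σ τ : Gal(L/K), σ (τ w) = τ (σ w)) :
    ∃ (k : ℕ) (u : K), g ^ p - c = c ^ k * u ^ p := by
  have : NeZero p := ⟨hp.ne_zero⟩
  have hB' : algebraMap K L B ≠ 0 := by simpa using hB
  have hβ0 : β ≠ 0 := by
    rintro rfl
    rw [zero_pow hp.ne_zero, eq_comm, map_eq_zero] at hβ
    exact hc 0 (by rw [zero_pow hp.ne_zero, hβ])
  obtain ⟨σ, hσ⟩ : ∃ σ : Gal(L/K), σ β ≠ β := by
    by_contra! hfix
    obtain ⟨u, rfl⟩ := (InfiniteGalois.mem_range_algebraMap_iff_fixed β).2 hfix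
    rw [← map_pow] at hβ
    exact hc u ((algebraMap K L).injective hβ)
  have hpow (τ : Gal(L/K)) : τ β ^ p = β ^ p := by rw [← map_pow, hβ, AlgEquiv.commutes]
  obtain ⟨j, hj⟩ := exists_rootOfUnity_smul hζ (hpow σ)
  set ξ : K := ζ ^ j with hξdef
  rw [← map_pow, ← hξdef] at hj
  have hξ : IsPrimitiveRoot ξ p := by
    have h1 : ξ ^ p = 1 := by rw [hξdef, ← pow_mul, mul_comm, pow_mul, hζ.pow_eq_one, one_pow]
    have h2 : ξ ≠ 1 := by
      intro h
      rw [h, map_one, one_mul] at hj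
      exact hσ hj
    have := Fact.mk hp
    exact IsPrimitiveRoot.iff_orderOf.2 (orderOf_eq_prime h1 h2)
  have hiter (i : ℕ) : (σ ^ i) β = algebraMap K L ξ ^ i * β := by
    induction i with
    | zero => simp
    | succ i ih =>
      rw [pow_succ', AlgEquiv.mul_apply, ih, map_mul, map_pow, AlgEquiv.commutes, hj, pow_succ]
      ring
  -- Up to the factor B, a p-th root of the norm of g - β.
  set W : L := ∏ i ∈ Finset.range p, (σ ^ i) w with hW
  have hWpow : (algebraMap K L B * W) ^ p = algebraMap K L (g ^ p - c) := by
    have h1 : ∀ i, (algebraMap K L B * (σ ^ i) w ^ p)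
        = algebraMap K L g - algebraMap K L ξ ^ i * β := by
      intro i
      have := congrArg (σ ^ i) hw
      rw [map_sub, map_mul, map_pow, AlgEquiv.commutes, AlgEquiv.commutes, hiter] at this
      exact this.symm
    have h2 := congrArg (eval (algebraMap K L g)) (X_pow_sub_C_eq_prod
      (hξ.map_of_injective (algebraMap K L).injective) hp.pos hβ)
    simp only [eval_sub, eval_pow, eval_X, eval_C, eval_prod] at h2
    rw [map_sub, map_pow, h2, Finset.prod_congr rfl fun i _ => (h1 i).symm,
      Finset.prod_mul_distrib, Finset.prod_const, Finset.card_range, Finset.prod_pow, mul_pow]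
  have hWfix (τ : Gal(L/K)) (hτ : τ β = β) : τ W = W := by
    have h1 : τ w ^ p = w ^ p := by
      have := congrArg τ hw
      rw [map_sub, map_mul, map_pow, AlgEquiv.commutes, AlgEquiv.commutes, hτ, hw] at this
      exact (mul_left_cancel₀ hB' this).symm
    obtain ⟨i, hi⟩ := exists_rootOfUnity_smul hζ h1
    -- Commutativity enters here: τ scales all p conjugates by the same root of unity, which cancels
    -- in the product.
    have h2 (m : ℕ) : τ ((σ ^ m) w) = algebraMap K L ζ ^ i * (σ ^ m) w := by
      rw [hcomm, hi, map_mul, map_pow, AlgEquiv.commutes]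
    rw [hW, map_prod, Finset.prod_congr rfl fun m _ => h2 m, Finset.prod_mul_distrib,
      Finset.prod_const, Finset.card_range, ← pow_mul, mul_comm i, pow_mul, ← map_pow,
      hζ.pow_eq_one, map_one, one_pow, one_mul]
  have hσW : σ W ^ p = W ^ p := by
    have := congrArg σ hWpow
    rw [AlgEquiv.commutes, ← hWpow, map_pow, map_mul, AlgEquiv.commutes, mul_pow, mul_pow] at this
    exact mul_left_cancel₀ (pow_ne_zero _ hB') this
  obtain ⟨k, hk⟩ := exists_rootOfUnity_smul hξ hσW
  set U : L := W / β ^ k with hU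
  have hξ0 : algebraMap K L ξ ≠ 0 := by simpa using hξ.ne_zero hp.ne_zero
  have hσU : σ U = U := by
    rw [hU, map_div₀, map_pow, hk, hj, mul_pow, mul_div_mul_left _ _ (pow_ne_zero _ hξ0)]
  have hσU' (i : ℕ) : (σ ^ i) U = U := by
    induction i with
    | zero => simp
    | succ i ih => rw [pow_succ', AlgEquiv.mul_apply, ih, hσU]
  have hUfix (τ : Gal(L/K)) : τ U = U := by
    obtain ⟨i, hi⟩ := exists_rootOfUnity_smul hξ (hpow τ)
    -- Any τ is a power of σ times an automorphism fixing β, and both factors fix U.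
    have h1 : ((σ ^ i)⁻¹ * τ) β = β := by
      rw [AlgEquiv.mul_apply, hi, ← hiter, ← AlgEquiv.mul_apply, inv_mul_cancel,
        AlgEquiv.one_apply]
    have h2 : ((σ ^ i)⁻¹ * τ) U = U := by
      rw [hU, map_div₀, map_pow, h1, hWfix _ h1]
    calc τ U = (σ ^ i) (((σ ^ i)⁻¹ * τ) U) := by
          rw [← AlgEquiv.mul_apply, mul_inv_cancel_left]
      _ = U := by rw [h2, hσU']
  obtain ⟨u, hu⟩ := (InfiniteGalois.mem_range_algebraMap_iff_fixed U).2 hUfix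
  refine ⟨k, B * u, (algebraMap K L).injective ?_⟩
  have h3 : W = β ^ k * algebraMap K L u := by
    rw [hu, hU, mul_div_cancel₀ _ (pow_ne_zero _ hβ0)]
  rw [← hWpow, h3, map_mul, map_pow, map_pow, map_mul, ← hβ]
  ring

end Kummer

/-! ### Galois action on the tree -/

section Tree

variable {K : Type*} [Field K]

theorem normal_arborealField (f : ℕ → K[X]) (α : K) : Normal K (arborealField f α) := by
  rw [IntermediateField.normal_iff_forall_map_le']
  intro σ
  rw [arborealField, IntermediateField.adjoin_map]
  refine IntermediateField.adjoin.mono _ _ _ ?_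
  rintro _ ⟨β, ⟨n, hn⟩, rfl⟩
  refine ⟨n, ?_⟩
  rw [aeval_algHom_apply, hn]
  exact σ.commutes α

/-- By normality, automorphisms of the separable closure restrict to the arboreal field. -/
theorem apply_comm_of_mem_arborealField (f : ℕ → K[X]) (α : K)
    (hab : ∀ σ τ : ArborealGroup f α, σ * τ = τ * σ) {w : SeparableClosure K}
    (hw : w ∈ arborealField f α) (σ τ : Gal(SeparableClosure K/K)) : σ (τ w) = τ (σ w) := by
  have := normal_arborealField f α
  have h := congrArg (algebraMap _ (SeparableClosure K)) (DFunLike.congr_fun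
    (hab (σ.restrictNormal (arborealField f α)) (τ.restrictNormal (arborealField f α))) ⟨w, hw⟩)
  simp only [AlgEquiv.mul_apply, AlgEquiv.restrictNormal_commutes] at h
  exact h

end Tree

/-! ### Classes modulo p-th powers -/

section PowerClasses

variable {K : Type*} [Field K]

theorem powerClass_mul (p : ℕ) (u v : Kˣ) :
    powerClass p (u * v) = powerClass p u + powerClass p v := rfl

theorem powerClass_pow_self (p : ℕ) (u : Kˣ) : powerClass p (u ^ p) = 0 :=
  congrArg Additive.ofMul
    ((QuotientGroup.eq_one_iff (N := (powMonoidHom p : Kˣ →* Kˣ).range) (u ^ p)).2 ⟨u, rfl⟩)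

theorem powerClass_pow (p : ℕ) (u : Kˣ) (k : ℕ) : powerClass p (u ^ k) = k • powerClass p u :=
  rfl

theorem exists_pow_eq_of_powerClass_eq_zero {p : ℕ} {u : Kˣ} (h : powerClass p u = 0) :
    ∃ v : Kˣ, v ^ p = u :=
  (QuotientGroup.eq_one_iff (N := (powMonoidHom p : Kˣ →* Kˣ).range) u).1
    (congrArg Additive.toMul h)

theorem powerClass_neg {p : ℕ} (hp : Odd p) (u : Kˣ) : powerClass p (-u) = powerClass p u := by
  have h : -u = (-1) ^ p * u := by rw [hp.neg_one_pow, neg_one_mul]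
  rw [h, powerClass_mul, powerClass_pow_self, zero_add]

end PowerClasses

/-- If `f_k - α` is irreducible then it has no root, so `(α - b_k) / a_k` is not a `d_k`-th power. -/
theorem pow_ne_of_irreducible_unicriticalSeq_sub_C {K : Type*} [Field K] (d : ℕ → ℕ)
    (a b : ℕ → K) (α : K) (k : ℕ) (hd : 2 ≤ d k) (ha : a k ≠ 0)
    (hirr : Irreducible (unicriticalSeq d a b k - C α)) (u : K) :
    u ^ d k ≠ (α - b k) / a k := by
  intro hu
  have hroot : (unicriticalSeq d a b k - C α).IsRoot u := by
    simp [unicriticalSeq, hu]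
    field_simp
    ring
  have h1 := natDegree_eq_of_degree_eq_some (degree_eq_one_of_irreducible_of_root hirr hroot)
  rw [natDegree_sub_C, natDegree_unicriticalSeq d a b k ha] at h1
  have h2 : d k = 1 := h1
  omega

end Arboreal

theorem Arboreal.adjustedPostCritical_div_eq_pow_mul_pow {K : Type*} [Field K] (p : ℕ → ℕ)
    (hp : ∀ k, 1 ≤ k → (p k).Prime) (hchar : ∀ k, 1 ≤ k → ringChar K ≠ p k)
    (hζ : ∃ ζ : K, IsPrimitiveRoot ζ (p 1))
    (a b : ℕ → K) (ha : ∀ k, 1 ≤ k → a k ≠ 0) (α : K)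
    (hirr : Irreducible (Arboreal.unicriticalSeq p a b 1 - Polynomial.C α))
    (hab : ∀ σ τ : Arboreal.ArborealGroup (Arboreal.unicriticalSeq p a b) α, σ * τ = τ * σ)
    (m : ℕ) (hm : p (m + 2) = p 1) :
    ∃ (k : ℕ) (u : K), Arboreal.adjustedPostCritical p a b α (m + 2) / a 1
      = ((α - b 1) / a 1) ^ k * u ^ p 1 := by
  set f := Arboreal.unicriticalSeq p a b with hf
  set L := SeparableClosure K
  have hcast (k : ℕ) (hk : 1 ≤ k) : (p k : K) ≠ 0 :=
    Arboreal.natCast_ne_zero_of_ringChar_ne (hp k hk) (hchar k hk)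
  have hroot (k : ℕ) (hk : 1 ≤ k) (γ : L) :
      ∃ δ : L, algebraMap K L (a k) * δ ^ p k + algebraMap K L (b k) = γ := by
    have h0 : algebraMap K L (a k) ≠ 0 := by simpa using ha k hk
    have : NeZero (p k : L) := ⟨by
      rw [← map_natCast (algebraMap K L)]
      exact (_root_.map_ne_zero _).2 (hcast k hk)⟩
    obtain ⟨δ, hδ⟩ := IsSepClosed.exists_pow_nat_eq
      ((γ - algebraMap K L (b k)) / algebraMap K L (a k)) (p k)
    exact ⟨δ, by rw [hδ, mul_div_cancel₀ _ h0, sub_add_cancel]⟩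
  have haeval (k : ℕ) (δ : L) :
      aeval δ (f k) = algebraMap K L (a k) * δ ^ p k + algebraMap K L (b k) := by
    simp [hf, Arboreal.unicriticalSeq]
  -- The middle factor f₂ ∘ ⋯ ∘ f_{m+1}; the outer and inner maps are treated separately.
  set q := Arboreal.compSeq (fun k => f (k + 1)) m with hq
  have hcomp : Arboreal.compSeq f (m + 2) = (f 1).comp (q.comp (f (m + 2))) :=
    Arboreal.compSeq_succ_eq_comp f (m + 1)
  have ha1 := ha 1 le_rfl
  obtain ⟨β, hβ⟩ := hroot 1 le_rfl (algebraMap K L α)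
  have hβp : β ^ p 1 = algebraMap K L ((α - b 1) / a 1) := by
    have h0 : algebraMap K L (a 1) ≠ 0 := by simpa using ha1
    rw [map_div₀, map_sub, eq_div_iff h0, ← hβ]
    ring
  obtain ⟨B, hB, w, hw, hBw⟩ := Arboreal.exists_aeval_sub_eq_mul_pow
    (Arboreal.arborealField f α).toSubfield (q := q) (β := β) (a := a (m + 2)) (b := b (m + 2))
    (Arboreal.natDegree_compSeq_ne_zero _ (fun k _ => by
      rw [hf, Arboreal.natDegree_unicriticalSeq p a b _ (ha _ (by omega))]
      exact (hp _ (by omega)).ne_zero) m)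
    (Arboreal.splits_map_compSeq_sub_C _ (fun k _ =>
      Arboreal.splits_map_unicriticalSeq_sub_C p a b _ (hcast _ (by omega)) (ha _ (by omega))) m β)
    (ha _ (by omega)) (p 1) (fun γ hγ => by
      obtain ⟨δ, hδ⟩ := hroot (m + 2) (by omega) γ
      refine ⟨δ, IntermediateField.subset_adjoin _ _ ⟨m + 2, ?_⟩, hm ▸ hδ⟩
      rw [hcomp, aeval_comp, aeval_comp, haeval (m + 2), hδ, hγ, haeval, hβ])
  obtain ⟨ζ, hζ⟩ := hζ
  obtain ⟨k, u, hku⟩ := Arboreal.exists_pow_sub_eq_pow_mul_pow (hp 1 le_rfl) hζ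
    (Arboreal.pow_ne_of_irreducible_unicriticalSeq_sub_C p a b α 1 (hp 1 le_rfl).two_le ha1 hirr)
    hβp hB hBw (Arboreal.apply_comm_of_mem_arborealField f α hab hw)
  refine ⟨k, u, ?_⟩
  rw [← hku, Arboreal.adjustedPostCritical, if_neg (by omega), ← hf, hcomp]
  have h2 : (f (m + 2)).eval 0 = b (m + 2) := by
    simp [hf, Arboreal.unicriticalSeq, (hp (m + 2) (by omega)).ne_zero]
  rw [eval_comp, eval_comp, h2]
  simp only [hf, Arboreal.unicriticalSeq, eval_add, eval_mul, eval_C, eval_pow, eval_X]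
  field_simp
  ring

theorem mainTheorem7 {K : Type*} [Field K] (p : ℕ → ℕ) (hp : ∀ k, 1 ≤ k → (p k).Prime)
    (hchar : ∀ k, 1 ≤ k → ringChar K ≠ p k)
    (hζ : ∃ ζ : K, IsPrimitiveRoot ζ (p 1))
    (a b : ℕ → K) (ha : ∀ k, 1 ≤ k → a k ≠ 0) (α : K)
    (hc : ∀ n, 1 ≤ n → Arboreal.adjustedPostCritical p a b α n ≠ 0)
    (hirr : Irreducible (Arboreal.unicriticalSeq p a b 1 - Polynomial.C α))
    (hab : ∀ σ τ : Arboreal.ArborealGroup (Arboreal.unicriticalSeq p a b) α, σ * τ = τ * σ) :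
    Module.finrank (ZMod (p 1))
      (Submodule.span (ZMod (p 1))
        (Arboreal.powerClass (p 1) ''
          {u : Kˣ | ∃ n, 1 ≤ n ∧ p n = p 1 ∧
            (u : K) = Arboreal.adjustedPostCritical p a b α n / a 1})) = 1 := by
  have hp1 := hp 1 le_rfl
  have ha1 := ha 1 le_rfl
  have := Fact.mk hp1
  have hc0 : (α - b 1) / a 1 ≠ 0 := by
    have h := Arboreal.pow_ne_of_irreducible_unicriticalSeq_sub_C p a b α 1 hp1.two_le ha1 hirr 0
    rw [zero_pow hp1.ne_zero] at h
    exact h.symm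
  set c : Kˣ := Units.mk0 _ hc0 with hcdef
  have hone (u : Kˣ) (hu : (u : K) = Arboreal.adjustedPostCritical p a b α 1 / a 1) :
      Arboreal.powerClass (p 1) u = Arboreal.powerClass (p 1) c := by
    have heval : (Arboreal.unicriticalSeq p a b 1).eval 0 = b 1 := by
      simp [Arboreal.unicriticalSeq, hp1.ne_zero]
    -- The sign convention at n = 1 matters only for p = 2; for odd p, -1 is a p-th power.
    rcases hp1.eq_two_or_odd' with h2 | hodd
    · congr 1
      ext
      rw [hu, Arboreal.adjustedPostCritical, if_pos ⟨h2, rfl⟩, heval]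
      rfl
    · have hu' : u = -c := by
        ext
        rw [hu, Arboreal.adjustedPostCritical, if_neg (fun h => by simp [h.1, Nat.odd_iff] at hodd),
          Units.val_neg, hcdef, Units.val_mk0, Arboreal.compSeq, Arboreal.compSeq, X_comp, heval]
        ring
      rw [hu', Arboreal.powerClass_neg hodd]
  have hspan : Submodule.span (ZMod (p 1)) (Arboreal.powerClass (p 1) ''
      {u : Kˣ | ∃ n, 1 ≤ n ∧ p n = p 1 ∧
        (u : K) = Arboreal.adjustedPostCritical p a b α n / a 1})
      = Submodule.span (ZMod (p 1)) {Arboreal.powerClass (p 1) c} := by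
    apply le_antisymm
    · rw [Submodule.span_le]
      rintro _ ⟨u, ⟨n, hn1, hnp, hu⟩, rfl⟩
      obtain rfl | ⟨m, rfl⟩ : n = 1 ∨ ∃ m, n = m + 2 := by
        rcases n with _ | _ | m
        · omega
        · exact Or.inl rfl
        · exact Or.inr ⟨m, rfl⟩
      · rw [hone u hu]
        exact Submodule.mem_span_singleton_self _
      · obtain ⟨k, v, hv⟩ := Arboreal.adjustedPostCritical_div_eq_pow_mul_pow p hp hchar hζ a b ha α
          hirr hab m hnp
        rw [← hu] at hv
        have hv0 : v ≠ 0 := by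
          rintro rfl
          rw [zero_pow hp1.ne_zero, mul_zero] at hv
          exact u.ne_zero hv
        have hu' : u = c ^ k * Units.mk0 v hv0 ^ p 1 := by
          ext
          simpa [hcdef] using hv
        rw [hu', Arboreal.powerClass_mul, Arboreal.powerClass_pow_self, add_zero,
          Arboreal.powerClass_pow]
        exact Submodule.smul_of_tower_mem _ k (Submodule.mem_span_singleton_self _)
    · rw [Submodule.span_singleton_le_iff_mem]
      refine Submodule.subset_span
        ⟨Units.mk0 _ (div_ne_zero (hc 1 le_rfl) ha1), ⟨1, le_rfl, rfl, rfl⟩, hone _ rfl⟩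
  rw [hspan]
  -- The line is nonzero because c is not a p-th power.
  refine finrank_span_singleton fun h => ?_
  obtain ⟨v, hv⟩ := Arboreal.exists_pow_eq_of_powerClass_eq_zero h
  refine Arboreal.pow_ne_of_irreducible_unicriticalSeq_sub_C p a b α 1 hp1.two_le ha1 hirr v ?_
  simpa [hcdef] using congrArg Units.val hv
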